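/- Let $(\Omega,\mathcal F,\mathbb P)$ be a probability space, $\alpha\in(0,1)$, and let $\mathbf X^{(1)},\mathbf X^{(2)},\dots$ be i.i.d. copies of a random vector $\mathbf X=(X_1,\dots,X_n)$ in $\mathbb R^n$. For a random variable $Y$ and $\beta\in(0,1)$ put $\mathrm{VaR}_\beta(Y)=\inf\{x\in\mathbb R:\mathbb P(Y\le x)\ge 1-\beta\}$, and define the diversification quotient $$\mathrm{DQ}^{\mathrm{VaR}}_\alpha(\mathbf X)=\frac{\alpha^*}{\alpha},\qquad \alpha^*=\inf\Big\{\beta\in(0,1):\mathrm{VaR}_\beta\Big(\sum_{i=1}^nX_i\Big)\le\sum_{i=1}^n\mathrm{VaR}_\alpha(X_i)\Big\},\qquad \inf\varnothing=1.$$ This number depends only on the law of $\mathbf X$. Its empirical estimator $\widehat{\mathrm{DQ}^{\mathrm{VaR}}_\alpha}(N)$ is the diversification quotient of a random vector distributed according to the empirical distribution $\frac1N\sum_{k=1}^N\delta_{\mathbf X^{(k)}}$. Let $F_i$ be the distribution function of $X_i$, let $G$ be the distribution function of $S=\sum_{i=1}^nX_i$, and put $t_i=F_i^{-1}(1-\alpha)=\inf\{x:F_i(x)\ge1-\alpha\}$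 for $1\le i\le n$ and $t_{n+1}=\sum_{i=1}^nt_i$. Suppose that each $F_i$ has a positive density at $t_i$, i.e. $F_i$ is differentiable at $t_i$ with $F_i'(t_i)=f_i(t_i)>0$, and that, on a neighbourhood of $t_{n+1}$, $G$ has a density $g$ (with respect to Lebesgue measure) that is continuous (and hence bounded) at $t_{n+1}$. Then, as $N\to\infty$, $$\sqrt N\left(\widehat{\mathrm{DQ}^{\mathrm{VaR}}_\alpha}(N)-\mathrm{DQ}^{\mathrm{VaR}}_\alpha(\mathbf X)\right)\xrightarrow{\ d\ }\mathrm N(0,\sigma^2),\qquad \sigma^2=\mathbf A^\top\Sigma\,\mathbf A\ge 0,$$ where $$\mathbf A=\left(\frac{g(t_{n+1})}{\alpha f_1(t_1)},\dots,\frac{g(t_{n+1})}{\alpha f_n(t_n)},-\frac1\alpha\right)$$ and $\Sigma$ is the covariance matrix of the random vector $(\mathbf 1_{\{X_1\le t_1\}},\dots,\mathbf 1_{\{X_n\le t_n\}},\mathbf 1_{\{S\le t_{n+1}\}})$. If $\sigma^2=0$, $\mathrm N(0,0)$ is the point mass at $0$. -/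

import Mathlib

open MeasureTheory ProbabilityTheory Filter Topology
open scoped Matrix

noncomputable section

namespace DivQuot

/-- The left quantile `F⁻¹(p) = inf {x : F x ≥ p}` of a distribution function. -/
def quantile (F : ℝ → ℝ) (p : ℝ) : ℝ := sInf {x : ℝ | p ≤ F x}

/-- Value at Risk at level `α` (small-`α` convention):
`VaR_α(Y) = inf {x : P(Y ≤ x) ≥ 1 - α}`. -/
def VaR {Ω : Type*} [MeasurableSpace Ω] (P : Measure Ω) (α : ℝ) (Y : Ω → ℝ) : ℝ :=
  sInf {x : ℝ | 1 - α ≤ P.real {ω | Y ω ≤ x}}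

open Classical in
/-- `α* = inf {β ∈ (0,1) : VaR_β(∑ X_i) ≤ ∑ VaR_α(X_i)}`, with the convention `inf ∅ = 1`. -/
def alphaStar {Ω : Type*} [MeasurableSpace Ω] {n : ℕ} (P : Measure Ω) (α : ℝ)
    (X : Ω → Fin n → ℝ) : ℝ :=
  let B : Set ℝ := {β : ℝ | β ∈ Set.Ioo (0 : ℝ) 1 ∧
    VaR P β (fun ω => ∑ i, X ω i) ≤ ∑ i, VaR P α (fun ω => X ω i)}
  if B.Nonempty then sInf B else 1

/-- The diversification quotient `DQ_α^VaR(X) = α* / α` of a random vector `X` under `P`. -/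
def DQVaR {Ω : Type*} [MeasurableSpace Ω] {n : ℕ} (P : Measure Ω) (α : ℝ)
    (X : Ω → Fin n → ℝ) : ℝ :=
  alphaStar P α X / α

/-- The empirical joint distribution `N⁻¹ ∑_{k < N} δ_{x k}` of the first `N` data points. -/
def empiricalMeasure {n : ℕ} (N : ℕ) (x : ℕ → Fin n → ℝ) : Measure (Fin n → ℝ) :=
  (N : ENNReal)⁻¹ • ∑ k ∈ Finset.range N, Measure.dirac (x k)

/-- The empirical estimator of `DQ_α^VaR`: the diversification quotient of a random vector
(here the identity map) whose law is the empirical joint distribution of the first `N` data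
points. -/
def empiricalDQVaR {n : ℕ} (N : ℕ) (α : ℝ) (x : ℕ → Fin n → ℝ) : ℝ :=
  DQVaR (empiricalMeasure N x) α (fun y : Fin n → ℝ => y)

/-- On a neighbourhood of `s`, the law `μ` has the (nonnegative, measurable) density `g` with
respect to Lebesgue measure. A density on the whole line is a special case. -/
def HasDensityNear (μ : Measure ℝ) (g : ℝ → ℝ) (s : ℝ) : Prop :=
  Measurable g ∧ (∀ x, 0 ≤ g x) ∧ ∃ ε : ℝ, 0 < ε ∧
    μ.restrict (Set.Ioo (s - ε) (s + ε)) =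
      (volume.restrict (Set.Ioo (s - ε) (s + ε))).withDensity (fun x => ENNReal.ofReal (g x))

/-- The random vector `(1{X_1 ≤ t_1}, …, 1{X_n ≤ t_n}, 1{S ≤ t_1 + ⋯ + t_n})`,
where `S = ∑ X_i`. -/
def indicatorVector {Ω : Type*} {n : ℕ} (X : Ω → Fin n → ℝ) (t : Fin n → ℝ) :
    Fin (n + 1) → Ω → ℝ :=
  Fin.snoc (α := fun _ => Ω → ℝ)
    (fun i => Set.indicator {ω | X ω i ≤ t i} (fun _ => (1 : ℝ)))
    (Set.indicator {ω | ∑ i, X ω i ≤ ∑ i, t i} (fun _ => (1 : ℝ)))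

/-- The covariance matrix of a real random vector. -/
def covarianceMatrix {Ω : Type*} [MeasurableSpace Ω] {m : ℕ} (P : Measure Ω)
    (Y : Fin m → Ω → ℝ) : Matrix (Fin m) (Fin m) ℝ :=
  Matrix.of fun i j => covariance (Y i) (Y j) P

/-- The vector `A = (g(s) / (α f_1(t_1)), …, g(s) / (α f_n(t_n)), -1/α)`, `s = ∑ t_i`. -/
def coeffVector {n : ℕ} (α : ℝ) (t : Fin n → ℝ) (f : Fin n → ℝ → ℝ) (g : ℝ → ℝ) :
    Fin (n + 1) → ℝ :=
  Fin.snoc (α := fun _ => ℝ) (fun i => g (∑ j, t j) / (α * f i (t i))) (-1 / α)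

/-- The asymptotic variance `σ² = Aᵀ Σ A`. -/
def asymptoticVariance {Ω : Type*} [MeasurableSpace Ω] {n : ℕ} (P : Measure Ω) (α : ℝ)
    (X : Ω → Fin n → ℝ) (t : Fin n → ℝ) (f : Fin n → ℝ → ℝ) (g : ℝ → ℝ) : ℝ :=
  coeffVector α t f g ⬝ᵥ
    (covarianceMatrix P (indicatorVector X t) *ᵥ coeffVector α t f g)

end DivQuot

end

namespace DivQuot

/-! The Galois connection between quantiles and distribution functions gives `α* = 1 - P(S ≤ ∑
VaR_α(X_i))` (`alphaStar_eq`). The same formula for the empirical measure turns the normalised error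
into `-1/α` times `√N (G_N(s + U/√N) - G(s))`, where `s = ∑ t_i` and `U` is `√N` times the error of
the summed empirical quantiles.

Near a point `t` with `F'(t) = d`, the process `u ↦ √N (F_N(t + u/√N) - F(t))` equals `W_N(t) + d u
+ o_P(1)`, with `W_N = √N (F_N - F)`. For fixed `u` this is Chebyshev plus differentiability. It is
uniform on compact sets because the process is monotone, so finitely many grid points suffice
(`tendsto_measure_exists_localFluctuation`).

This is used twice. The normalised quantile error is where the local process of `F_i` crosses zero,
hence `-W_i/f_i(t_i) + o_P(1)` (`isLittleOInProb_quantile_add`). In particular `U = O_P(1)`, so the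
local process of `G` may be evaluated at `U`. The error is then a linear combination of the
`W_i(t_i)` and `W_S(s)` up to `o_P(1)`. That combination is a normalised sum of i.i.d. bounded
scalars, so the one-dimensional central limit theorem and Slutsky's lemma conclude. -/

/-! ### Quantiles, Value at Risk and a closed form for `α*`. -/

/-- Quantiles of a distribution function form a Galois connection with it. -/
lemma quantile_cdf_le_iff (μ : Measure ℝ) {p : ℝ} (hp : p ∈ Set.Ioo (0 : ℝ) 1) (c : ℝ) :
    quantile (cdf μ) p ≤ c ↔ p ≤ cdf μ c := by
  have hne : {x : ℝ | p ≤ cdf μ x}.Nonempty :=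
    ((tendsto_cdf_atTop μ).eventually (eventually_ge_nhds hp.2)).exists
  have hbdd : BddBelow {x : ℝ | p ≤ cdf μ x} := by
    obtain ⟨a, ha⟩ := ((tendsto_cdf_atBot μ).eventually (eventually_lt_nhds hp.1)).exists
    refine ⟨a, fun x hx => ?_⟩
    by_contra! h
    exact absurd (hx.trans (monotone_cdf μ h.le)) (not_le.2 ha)
  refine ⟨fun h => ?_, fun h => csInf_le hbdd h⟩
  -- Each `x > c` lies above a point of the set; right continuity carries the inequality down to
  -- `c`.
  have hright : ∀ᶠ x in 𝓝[>] c, p ≤ cdf μ x := by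
    filter_upwards [self_mem_nhdsWithin] with x hx
    obtain ⟨y, hy, hyx⟩ := exists_lt_of_csInf_lt hne (lt_of_le_of_lt h hx)
    exact hy.trans (monotone_cdf μ hyx.le)
  have hlim : Tendsto (cdf μ) (𝓝[>] c) (𝓝 (cdf μ c)) :=
    ((cdf μ).right_continuous c).mono_left (nhdsWithin_mono _ Set.Ioi_subset_Ici_self)
  exact ge_of_tendsto hlim hright

section VaR

variable {Ω : Type*} [MeasurableSpace Ω] {P : Measure Ω} [IsProbabilityMeasure P]

lemma cdf_map_eq {Y : Ω → ℝ} (hY : AEMeasurable Y P) (x : ℝ) :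
    cdf (P.map Y) x = P.real {ω | Y ω ≤ x} := by
  have := Measure.isProbabilityMeasure_map hY
  rw [cdf_eq_real, Measure.real, Measure.map_apply_of_aemeasurable hY measurableSet_Iic]
  rfl

lemma VaR_eq_quantile {Y : Ω → ℝ} (hY : AEMeasurable Y P) (β : ℝ) :
    VaR P β Y = quantile (cdf (P.map Y)) (1 - β) := by
  simp only [VaR, quantile, cdf_map_eq hY]

lemma VaR_le_iff {Y : Ω → ℝ} (hY : AEMeasurable Y P) {β : ℝ} (hβ : β ∈ Set.Ioo (0 : ℝ) 1)
    (c : ℝ) : VaR P β Y ≤ c ↔ 1 - β ≤ P.real {ω | Y ω ≤ c} := by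
  rw [VaR_eq_quantile hY, quantile_cdf_le_iff _ ⟨by linarith [hβ.2], by linarith [hβ.1]⟩,
    cdf_map_eq hY]

/-- By the Galois connection the admissible `β` are those in `(0,1)` with `1 - q ≤ β`. For `q = 0`
there are none, and the convention `inf ∅ = 1` gives exactly the value required. -/
lemma alphaStar_eq {n : ℕ} {X : Ω → Fin n → ℝ} (hX : AEMeasurable X P) (α : ℝ) :
    alphaStar P α X =
      1 - P.real {ω | ∑ i, X ω i ≤ ∑ i, VaR P α (fun ω => X ω i)} := by
  have hS : AEMeasurable (fun ω => ∑ i, X ω i) P :=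
    (show Measurable fun x : Fin n → ℝ => ∑ i, x i by fun_prop).comp_aemeasurable hX
  set s := ∑ i, VaR P α (fun ω => X ω i)
  set q := P.real {ω | ∑ i, X ω i ≤ s} with hq
  have hq0 : 0 ≤ q := measureReal_nonneg
  have hq1 : q ≤ 1 := measureReal_le_one
  have hB : {β : ℝ | β ∈ Set.Ioo (0 : ℝ) 1 ∧ VaR P β (fun ω => ∑ i, X ω i) ≤ s} =
      {β : ℝ | β ∈ Set.Ioo (0 : ℝ) 1 ∧ 1 - q ≤ β} := by
    ext β
    refine and_congr_right fun hβ => ?_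
    rw [VaR_le_iff hS hβ, ← hq]
    constructor <;> intro h <;> linarith
  simp only [alphaStar]
  rw [hB]
  rcases hq0.eq_or_lt with h0 | h0
  · rw [if_neg]
    · rw [← h0, sub_zero]
    · rintro ⟨β, hβ, h⟩
      linarith [hβ.2]
  rcases hq1.eq_or_lt with h1 | h1
  · have : {β : ℝ | β ∈ Set.Ioo (0 : ℝ) 1 ∧ 1 - q ≤ β} = Set.Ioo 0 1 := by
      ext β
      simp only [Set.mem_ofPred_eq, and_iff_left_iff_imp]
      intro hβ
      linarith [hβ.1]
    rw [this, if_pos (by simp), csInf_Ioo one_pos, h1, sub_self]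
  · have : {β : ℝ | β ∈ Set.Ioo (0 : ℝ) 1 ∧ 1 - q ≤ β} = Set.Ico (1 - q) 1 := by
      ext β
      constructor
      · rintro ⟨h, h'⟩
        exact ⟨h', h.2⟩
      · rintro ⟨h, h'⟩
        exact ⟨⟨by linarith, h'⟩, h⟩
    have hlt : 1 - q < 1 := by linarith
    rw [this, if_pos (by simpa using hlt), csInf_Ico hlt]

end VaR

/-! ### The empirical distribution and the estimator. -/

/-- The empirical distribution function of the first `N` terms of a real sequence. -/
noncomputable def ecdf (y : ℕ → ℝ) (N : ℕ) (x : ℝ) : ℝ :=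
  (N : ℝ)⁻¹ * ∑ k ∈ Finset.range N, (Set.Iic x).indicator (fun _ => (1 : ℝ)) (y k)

lemma ecdf_mono (y : ℕ → ℝ) (N : ℕ) : Monotone (ecdf y N) := by
  intro a b hab
  unfold ecdf
  gcongr

lemma isProbabilityMeasure_empiricalMeasure {n N : ℕ} (hN : N ≠ 0) (x : ℕ → Fin n → ℝ) :
    IsProbabilityMeasure (empiricalMeasure N x) := by
  constructor
  simp only [empiricalMeasure, Measure.smul_apply, Measure.finsetSum_apply, measure_univ,
    Finset.sum_const, Finset.card_range, nsmul_eq_mul, mul_one, smul_eq_mul]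
  exact ENNReal.inv_mul_cancel (by exact_mod_cast hN) (ENNReal.natCast_ne_top N)

lemma empiricalMeasure_real_le {n : ℕ} (N : ℕ) (x : ℕ → Fin n → ℝ) {φ : (Fin n → ℝ) → ℝ}
    (hφ : Measurable φ) (c : ℝ) :
    (empiricalMeasure N x).real {z | φ z ≤ c} = ecdf (fun k => φ (x k)) N c := by
  have hm : MeasurableSet {z | φ z ≤ c} := measurableSet_le hφ measurable_const
  simp only [Measure.real, empiricalMeasure, Measure.smul_apply, Measure.finsetSum_apply,
    Measure.dirac_apply' _ hm, smul_eq_mul, ENNReal.toReal_mul, ENNReal.toReal_inv,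
    ENNReal.toReal_natCast, ecdf]
  rw [ENNReal.toReal_sum]
  · congr 1
    refine Finset.sum_congr rfl fun k _ => ?_
    by_cases h : φ (x k) ≤ c <;> simp [Set.indicator, h]
  · intro k _
    by_cases h : φ (x k) ≤ c <;> simp [Set.indicator, h]

/-- The empirical Value at Risk of the first `N` terms of a real sequence. -/
noncomputable def empiricalVaR (N : ℕ) (α : ℝ) (y : ℕ → ℝ) : ℝ := quantile (ecdf y N) (1 - α)

lemma VaR_empiricalMeasure {n : ℕ} (N : ℕ) (x : ℕ → Fin n → ℝ) (α : ℝ) (i : Fin n) :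
    VaR (empiricalMeasure N x) α (fun z => z i) = empiricalVaR N α (fun k => x k i) := by
  simp only [VaR, empiricalVaR, quantile,
    empiricalMeasure_real_le N x (φ := fun z => z i) (by fun_prop)]

lemma empiricalDQVaR_eq {n N : ℕ} (hN : N ≠ 0) (α : ℝ) (x : ℕ → Fin n → ℝ) :
    empiricalDQVaR N α x =
      (1 - ecdf (fun k => ∑ i, x k i) N (∑ i, empiricalVaR N α (fun k => x k i))) / α := by
  have := isProbabilityMeasure_empiricalMeasure hN x
  rw [empiricalDQVaR, DQVaR, alphaStar_eq (by fun_prop),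
    empiricalMeasure_real_le N x (φ := fun z => ∑ i, z i) (by fun_prop)]
  simp only [VaR_empiricalMeasure]

/-- Regarding the sequence as a sample in `Fin 1 → ℝ` makes this an instance of `VaR_le_iff`. -/
lemma empiricalVaR_le_iff {N : ℕ} (hN : N ≠ 0) {α : ℝ} (hα : α ∈ Set.Ioo (0 : ℝ) 1) (y : ℕ → ℝ)
    (c : ℝ) : empiricalVaR N α y ≤ c ↔ 1 - α ≤ ecdf y N c := by
  let x : ℕ → Fin 1 → ℝ := fun k _ => y k
  have := isProbabilityMeasure_empiricalMeasure hN x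
  have h := VaR_le_iff (P := empiricalMeasure N x) (Y := fun z => z 0)
    (measurable_pi_apply 0).aemeasurable hα c
  rwa [VaR_empiricalMeasure, empiricalMeasure_real_le N x (φ := fun z => z 0) (by fun_prop)] at h

lemma measurable_ecdf (N : ℕ) (x : ℝ) : Measurable fun y : ℕ → ℝ => ecdf y N x := by
  unfold ecdf
  refine (Finset.measurable_sum _ fun k _ => ?_).const_mul _
  exact (measurable_const.indicator measurableSet_Iic).comp (measurable_pi_apply k)

lemma measurable_empiricalVaR {N : ℕ} (hN : N ≠ 0) {α : ℝ} (hα : α ∈ Set.Ioo (0 : ℝ) 1) :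
    Measurable fun y : ℕ → ℝ => empiricalVaR N α y := by
  refine measurable_of_Iic fun c => ?_
  have : (fun y : ℕ → ℝ => empiricalVaR N α y) ⁻¹' Set.Iic c = {y | 1 - α ≤ ecdf y N c} := by
    ext y
    exact empiricalVaR_le_iff hN hα y c
  rw [this]
  exact measurableSet_le measurable_const (measurable_ecdf N c)

lemma measurable_empiricalDQVaR {n N : ℕ} (hN : N ≠ 0) {α : ℝ} (hα : α ∈ Set.Ioo (0 : ℝ) 1) :
    Measurable fun x : ℕ → Fin n → ℝ => empiricalDQVaR N α x := by
  have hV : Measurable fun x : ℕ → Fin n → ℝ => ∑ i, empiricalVaR N α (fun k => x k i) :=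
    Finset.measurable_sum _ fun i _ =>
      (measurable_empiricalVaR hN hα).comp (by fun_prop)
  simp only [empiricalDQVaR_eq hN, ecdf]
  refine (measurable_const.sub (Measurable.const_mul (Finset.measurable_sum _ fun k _ => ?_)
    _)).div_const _
  have hset : MeasurableSet {x : ℕ → Fin n → ℝ |
      ∑ i, x k i ≤ ∑ i, empiricalVaR N α (fun k => x k i)} :=
    measurableSet_le (by fun_prop) hV
  exact (measurable_const (a := (1 : ℝ))).indicator hset

/-! ### Two analytic facts: control on a grid, and differentiability from a local density. -/

/-- A monotone function that is within `η` of an affine function on a grid of mesh `h` is within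
`η + |d| h` of it in between. -/
lemma abs_sub_affine_lt_of_grid {H : ℝ → ℝ} (hH : Monotone H) {K h w d η : ℝ} (hh : 0 < h)
    (hgrid : ∀ j ∈ Finset.range (⌊2 * K / h⌋₊ + 2),
      |H (-K + j * h) - w - d * (-K + j * h)| < η)
    {u : ℝ} (hu : |u| ≤ K) : |H u - w - d * u| < η + |d| * h := by
  obtain ⟨hu1, hu2⟩ := abs_le.1 hu
  set j := ⌊(u + K) / h⌋₊ with hj
  have hjle : j ≤ ⌊2 * K / h⌋₊ := by
    apply Nat.floor_mono
    gcongr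
    linarith
  have h1 : (j : ℝ) * h ≤ u + K := by
    rw [← le_div_iff₀ hh]
    exact Nat.floor_le (div_nonneg (by linarith) hh.le)
  have h2 : u + K < ((j : ℝ) + 1) * h := by
    rw [← div_lt_iff₀ hh]
    exact Nat.lt_floor_add_one _
  have g1 := abs_lt.1 (hgrid j (Finset.mem_range.2 (by omega)))
  have g2 := abs_lt.1 (hgrid (j + 1) (Finset.mem_range.2 (by omega)))
  push_cast at g2
  have m1 : H (-K + j * h) ≤ H u := hH (by linarith)
  have m2 : H u ≤ H (-K + (j + 1) * h) := hH (by linarith)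
  have d1 : |d * (u - (-K + j * h))| ≤ |d| * h := by
    rw [abs_mul]
    gcongr
    rw [abs_le]
    constructor <;> linarith
  have d2 : |d * (u - (-K + (j + 1) * h))| ≤ |d| * h := by
    rw [abs_mul]
    gcongr
    rw [abs_le]
    constructor <;> linarith
  rw [abs_le] at d1 d2
  rw [abs_lt]
  constructor <;> linarith [d1.1, d1.2, d2.1, d2.2, g1.1, g2.2, mul_sub d u (-K + j * h),
    mul_sub d u (-K + (j + 1) * h)]

/-- The distribution function is differentiable where there is a continuous density. -/
lemma HasDensityNear.hasDerivAt_cdf {μ : Measure ℝ} [IsProbabilityMeasure μ] {g : ℝ → ℝ} {s : ℝ}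
    (hg : HasDensityNear μ g s) (hc : ContinuousAt g s) : HasDerivAt (cdf μ) (g s) s := by
  obtain ⟨hgm, hg0, ε, hε, hμ⟩ := hg
  set I := Set.Ioo (s - ε) (s + ε) with hI
  have hint : IntegrableOn g I := by
    refine ⟨hgm.aestronglyMeasurable, ?_⟩
    rw [hasFiniteIntegral_iff_ofReal (ae_of_all _ hg0)]
    have := congrArg (fun ν => ν Set.univ) hμ
    simp only [withDensity_apply _ MeasurableSet.univ, Measure.restrict_univ] at this
    rw [← this]
    exact measure_lt_top _ _
  -- A base point strictly left of `s` inside the neighbourhood, so that one integral formula covers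
  -- both sides of `s`.
  set a := s - ε / 2 with ha
  have hsub : ∀ x ∈ I, a ≤ x → Set.Ioc a x ⊆ I := fun x hx _ y hy =>
    ⟨by linarith [hy.1], hy.2.trans_lt hx.2⟩
  have hkey : ∀ x ∈ I, a ≤ x → cdf μ x = cdf μ a + ∫ y in a..x, g y := by
    intro x hx hax
    have h1 : μ (Set.Ioc a x) = ENNReal.ofReal (∫ y in a..x, g y) := by
      have := congrArg (fun ν => ν (Set.Ioc a x)) hμ
      simp only [withDensity_apply _ measurableSet_Ioc,
        Measure.restrict_apply measurableSet_Ioc,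
        Measure.restrict_restrict measurableSet_Ioc,
        Set.inter_eq_left.2 (hsub x hx hax)] at this
      rw [this, intervalIntegral.integral_of_le hax,
        ofReal_integral_eq_lintegral_ofReal (hint.mono_set (hsub x hx hax)) (ae_of_all _ hg0)]
    have h2 : μ (Set.Ioc a x) = ENNReal.ofReal (cdf μ x - cdf μ a) := by
      conv_lhs => rw [← measure_cdf μ]
      exact (cdf μ).measure_Ioc a x
    rw [h1, ENNReal.ofReal_eq_ofReal_iff (intervalIntegral.integral_nonneg hax fun y _ => hg0 y)
      (sub_nonneg.2 (monotone_cdf μ hax))] at h2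
    linarith
  have hs : s ∈ I := ⟨by linarith, by linarith⟩
  have has : a ≤ s := by linarith
  have hd : HasDerivAt (fun x => ∫ y in a..x, g y) (g s) s :=
    intervalIntegral.integral_hasDerivAt_right
      ((intervalIntegrable_iff_integrableOn_Ioc_of_le has).2 (hint.mono_set (hsub s hs has)))
      hgm.stronglyMeasurable.stronglyMeasurableAtFilter hc
  refine (hd.const_add (cdf μ a)).congr_of_eventuallyEq ?_
  filter_upwards [Ioo_mem_nhds (show a < s by linarith) (show s < s + ε by linarith)] with x hx
  exact hkey x ⟨by linarith [hx.1], hx.2⟩ hx.1.le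


/-! ### Calculus of `o_P(1)` and `O_P(1)`. -/

section InProbability

variable {Ω : Type*} [MeasurableSpace Ω] {P : Measure Ω}

/-- The real sequence `R` is `o_P(1)`. -/
def IsLittleOInProb (P : Measure Ω) (R : ℕ → Ω → ℝ) : Prop :=
  ∀ ε : ℝ, 0 < ε → Tendsto (fun N => P {ω | ε ≤ |R N ω|}) atTop (𝓝 0)

/-- The real sequence `U` is `O_P(1)`. -/
def IsBigOInProb (P : Measure Ω) (U : ℕ → Ω → ℝ) : Prop :=
  ∀ δ : ENNReal, 0 < δ → ∃ K : ℝ, ∀ᶠ N in atTop, P {ω | K < |U N ω|} ≤ δ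

/-- Eventual equality is enough, which matters because identities that divide by `√N` may fail at `N
= 0`. -/
lemma IsLittleOInProb.congr {R R' : ℕ → Ω → ℝ} (hR : IsLittleOInProb P R)
    (h : ∀ᶠ N in atTop, ∀ ω, R N ω = R' N ω) : IsLittleOInProb P R' := by
  intro ε hε
  refine (hR ε hε).congr' ?_
  filter_upwards [h] with N hN
  simp only [hN]

lemma IsLittleOInProb.add {R R' : ℕ → Ω → ℝ} (hR : IsLittleOInProb P R)
    (hR' : IsLittleOInProb P R') : IsLittleOInProb P (fun N ω => R N ω + R' N ω) := by
  intro ε hε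
  have h := (hR (ε / 2) (by positivity)).add (hR' (ε / 2) (by positivity))
  rw [add_zero] at h
  refine tendsto_of_tendsto_of_tendsto_of_le_of_le tendsto_const_nhds h (fun _ => zero_le)
    fun N => (measure_mono fun ω hω => ?_).trans (measure_union_le _ _)
  by_contra hn
  simp only [Set.mem_union, Set.mem_ofPred_eq, not_or, not_le] at hn hω
  linarith [abs_add_le (R N ω) (R' N ω), hn.1, hn.2]

lemma IsLittleOInProb.const_mul {R : ℕ → Ω → ℝ} (hR : IsLittleOInProb P R) (c : ℝ) :
    IsLittleOInProb P (fun N ω => c * R N ω) := by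
  intro ε hε
  refine tendsto_of_tendsto_of_tendsto_of_le_of_le tendsto_const_nhds
    (hR (ε / (|c| + 1)) (by positivity)) (fun _ => zero_le)
    fun N => measure_mono fun ω hω => ?_
  simp only [Set.mem_ofPred_eq, abs_mul] at hω ⊢
  rw [div_le_iff₀ (by positivity)]
  nlinarith [abs_nonneg (R N ω)]

lemma IsLittleOInProb.sum {ι : Type*} (s : Finset ι) {R : ι → ℕ → Ω → ℝ}
    (hR : ∀ i ∈ s, IsLittleOInProb P (R i)) :
    IsLittleOInProb P (fun N ω => ∑ i ∈ s, R i N ω) := by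
  classical
  induction s using Finset.induction_on with
  | empty =>
    intro ε hε
    simp [hε.not_ge]
  | insert i s hi ih =>
    simp only [Finset.sum_insert hi]
    exact (hR i (Finset.mem_insert_self i s)).add
      (ih fun j hj => hR j (Finset.mem_insert_of_mem hj))

lemma isLittleOInProb_of_tendsto {a : ℕ → ℝ} (ha : Tendsto a atTop (𝓝 0)) :
    IsLittleOInProb P (fun N _ => a N) := by
  intro ε hε
  refine tendsto_const_nhds.congr' ?_
  filter_upwards [(tendsto_zero_iff_abs_tendsto_zero a).1 ha |>.eventually (gt_mem_nhds hε)]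
    with N hN
  simp [show ¬ε ≤ |a N| from not_le.2 hN]

lemma IsLittleOInProb.isBigOInProb {R : ℕ → Ω → ℝ} (hR : IsLittleOInProb P R) :
    IsBigOInProb P R := fun δ hδ =>
  ⟨1, (ENNReal.tendsto_nhds_zero.1 (hR 1 one_pos) δ hδ).mono fun _ h =>
    h.trans' (measure_mono fun ω (hω : 1 < |R _ ω|) => hω.le)⟩

lemma IsBigOInProb.congr {U U' : ℕ → Ω → ℝ} (hU : IsBigOInProb P U)
    (h : ∀ᶠ N in atTop, ∀ ω, U N ω = U' N ω) : IsBigOInProb P U' := by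
  intro δ hδ
  obtain ⟨K, hK⟩ := hU δ hδ
  refine ⟨K, ?_⟩
  filter_upwards [h, hK] with N hN hKN
  simpa only [hN] using hKN

lemma IsBigOInProb.add {U U' : ℕ → Ω → ℝ} (hU : IsBigOInProb P U) (hU' : IsBigOInProb P U') :
    IsBigOInProb P (fun N ω => U N ω + U' N ω) := by
  intro δ hδ
  obtain ⟨K, hK⟩ := hU (δ / 2) (ENNReal.half_pos hδ.ne')
  obtain ⟨K', hK'⟩ := hU' (δ / 2) (ENNReal.half_pos hδ.ne')
  refine ⟨K + K', ?_⟩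
  filter_upwards [hK, hK'] with N h h'
  calc P {ω | K + K' < |U N ω + U' N ω|}
      ≤ P ({ω | K < |U N ω|} ∪ {ω | K' < |U' N ω|}) := by
        refine measure_mono fun ω hω => ?_
        by_contra hn
        simp only [Set.mem_union, Set.mem_ofPred_eq, not_or, not_lt] at hn hω
        linarith [abs_add_le (U N ω) (U' N ω), hn.1, hn.2]
    _ ≤ δ / 2 + δ / 2 := (measure_union_le _ _).trans (add_le_add h h')
    _ = δ := ENNReal.add_halves δ

lemma IsBigOInProb.const_mul {U : ℕ → Ω → ℝ} (hU : IsBigOInProb P U) (c : ℝ) :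
    IsBigOInProb P (fun N ω => c * U N ω) := by
  intro δ hδ
  obtain ⟨K, hK⟩ := hU δ hδ
  refine ⟨|c| * K, hK.mono fun N h => (measure_mono fun ω hω => ?_).trans h⟩
  simp only [Set.mem_ofPred_eq, abs_mul] at hω ⊢
  exact lt_of_mul_lt_mul_left hω (abs_nonneg c)

lemma IsBigOInProb.sum {ι : Type*} (s : Finset ι) {U : ι → ℕ → Ω → ℝ}
    (hU : ∀ i ∈ s, IsBigOInProb P (U i)) :
    IsBigOInProb P (fun N ω => ∑ i ∈ s, U i N ω) := by
  classical
  induction s using Finset.induction_on with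
  | empty => exact fun δ _ => ⟨0, by simp⟩
  | insert i s hi ih =>
    simp only [Finset.sum_insert hi]
    exact (hU i (Finset.mem_insert_self i s)).add
      (ih fun j hj => hU j (Finset.mem_insert_of_mem hj))

end InProbability

/-! ### Empirical processes: tightness, local linearity, Bahadur representation. -/

/-- The empirical process `√N (F_N - F)`, where `F_N` is the empirical distribution function. -/
noncomputable def empiricalFluctuation (μ : Measure ℝ) (y : ℕ → ℝ) (N : ℕ) (x : ℝ) : ℝ :=
  √N * (ecdf y N x - cdf μ x)

/-- The localised empirical process `u ↦ √N (F_N (t + u / √N) - F t)`. -/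
noncomputable def localFluctuation (μ : Measure ℝ) (t : ℝ) (y : ℕ → ℝ) (N : ℕ) (u : ℝ) : ℝ :=
  √N * (ecdf y N (t + u / √N) - cdf μ t)

lemma monotone_localFluctuation (μ : Measure ℝ) (t : ℝ) (y : ℕ → ℝ) (N : ℕ) :
    Monotone (localFluctuation μ t y N) := by
  intro a b hab
  unfold localFluctuation
  gcongr
  exact ecdf_mono y N (by gcongr)

/-- This is the right derivative at `0` of `v ↦ F (t + v * u)`, taken along `v = 1/√N`. -/
lemma tendsto_sqrt_mul_increment {F : ℝ → ℝ} {d t : ℝ} (hF : HasDerivAt F d t) (u : ℝ) :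
    Tendsto (fun N : ℕ => √N * (F (t + u / √N) - F t)) atTop (𝓝 (d * u)) := by
  have h1 : HasDerivAt (fun v : ℝ => F (t + v * u)) (d * u) 0 := by
    have h2 : HasDerivAt (fun v : ℝ => t + v * u) u 0 := by
      simpa using ((hasDerivAt_id (0 : ℝ)).mul_const u).const_add t
    have h3 : HasDerivAt F d (t + 0 * u) := by simpa using hF
    exact h3.comp 0 h2
  have hs : Tendsto (fun N : ℕ => √(N : ℝ)) atTop atTop :=
    Real.tendsto_sqrt_atTop.comp tendsto_natCast_atTop_atTop
  have h4 := h1.tendsto_slope_zero_right.comp (tendsto_inv_atTop_nhdsGT_zero.comp hs)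
  refine h4.congr fun N => ?_
  simp [div_eq_inv_mul]

section Sampling

variable {Ω : Type*} [MeasurableSpace Ω] {P : Measure Ω} [IsProbabilityMeasure P]

/-- Chebyshev's inequality for a normalised empirical mean. -/
lemma measure_le_abs_sqrt_mul_mean_sub_le {μ : Measure ℝ} [IsProbabilityMeasure μ]
    {Y : ℕ → Ω → ℝ} (hindep : iIndepFun Y P) (hlaw : ∀ k, HasLaw (Y k) μ P) {h : ℝ → ℝ}
    (hm : Measurable h) (hh : MemLp h 2 μ) (N : ℕ) {c : ℝ} (hc : 0 < c) :
    P {ω | c ≤ |√N * ((N : ℝ)⁻¹ * ∑ k ∈ Finset.range N, h (Y k ω) - ∫ x, h x ∂μ)|} ≤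
      ENNReal.ofReal ((∫ x, h x ^ 2 ∂μ) / c ^ 2) := by
  have hLp : ∀ k, MemLp (fun ω => h (Y k ω)) 2 P := fun k =>
    ((hlaw k).map_eq.symm ▸ hh).comp_of_map (hlaw k).aemeasurable
  have hE : ∀ k, ∫ ω, h (Y k ω) ∂P = ∫ x, h x ∂μ := fun k =>
    (hlaw k).integral_comp hm.aestronglyMeasurable
  have hV : ∀ k, Var[fun ω => h (Y k ω); P] = Var[h; μ] := fun k => by
    rw [← (hlaw k).map_eq, variance_map hm.aemeasurable (hlaw k).aemeasurable]
    rfl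
  have hsum : Var[fun ω => ∑ k ∈ Finset.range N, h (Y k ω); P] = N * Var[h; μ] := by
    have := IndepFun.variance_sum (μ := P) (X := fun k ω => h (Y k ω)) (s := Finset.range N)
      (fun k _ => hLp k)
      (fun i _ j _ hij => (hindep.indepFun hij).comp hm hm)
    rw [Finset.sum_congr rfl fun k _ => hV k] at this
    simp only [Finset.sum_const, Finset.card_range, nsmul_eq_mul] at this
    rw [← this]
    congr 1
    ext ω
    simp
  rcases N.eq_zero_or_pos with rfl | hN
  · simp [hc.not_ge]
  have hN' : (0 : ℝ) < N := by exact_mod_cast hN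
  set Z : Ω → ℝ := fun ω => √N * (N : ℝ)⁻¹ * ∑ k ∈ Finset.range N, h (Y k ω) with hZ
  have hZLp : MemLp Z 2 P := (memLp_finsetSum _ fun k _ => hLp k).const_mul _
  have hsq : (√(N : ℝ) * (N : ℝ)⁻¹) ^ 2 * N = 1 := by
    rw [mul_pow, Real.sq_sqrt hN'.le]
    field_simp
  have hVZ : Var[Z; P] = Var[h; μ] := by
    rw [hZ, variance_const_mul, hsum, ← mul_assoc, hsq, one_mul]
  have hEZ : ∫ ω, Z ω ∂P = √N * ∫ x, h x ∂μ := by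
    rw [hZ, integral_const_mul, integral_finsetSum _ fun k _ => (hLp k).integrable one_le_two]
    simp only [hE, Finset.sum_const, Finset.card_range, nsmul_eq_mul]
    field_simp
  have hcheb := meas_ge_le_variance_div_sq hZLp hc
  rw [hEZ, hVZ] at hcheb
  calc _ = P {ω | c ≤ |Z ω - √N * ∫ x, h x ∂μ|} := by
        simp only [hZ, mul_sub, mul_assoc]
    _ ≤ _ := hcheb
    _ ≤ _ := by
        gcongr
        exact variance_le_expectation_sq hm.aestronglyMeasurable

variable {μ : Measure ℝ} [IsProbabilityMeasure μ] {Y : ℕ → Ω → ℝ}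

lemma integral_indicator_Iic (μ : Measure ℝ) [IsProbabilityMeasure μ] (a : ℝ) :
    ∫ x, (Set.Iic a).indicator (fun _ => (1 : ℝ)) x ∂μ = cdf μ a := by
  rw [cdf_eq_real]
  exact integral_indicator_one measurableSet_Iic

lemma memLp_indicator_Iic (μ : Measure ℝ) [IsProbabilityMeasure μ] (a : ℝ) (p : ENNReal) :
    MemLp ((Set.Iic a).indicator (fun _ => (1 : ℝ))) p μ :=
  (memLp_const 1).indicator measurableSet_Iic

/-- An indicator is its own square, so its second moment is `F(a) ≤ 1`. The bound does not depend on
`N`, which yields tightness. -/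
lemma measure_le_abs_empiricalFluctuation_le (hindep : iIndepFun Y P)
    (hlaw : ∀ k, HasLaw (Y k) μ P) (N : ℕ) (a : ℝ) {c : ℝ} (hc : 0 < c) :
    P {ω | c ≤ |empiricalFluctuation μ (fun k => Y k ω) N a|} ≤ ENNReal.ofReal (1 / c ^ 2) := by
  have h := measure_le_abs_sqrt_mul_mean_sub_le hindep hlaw
    (measurable_const.indicator measurableSet_Iic) (memLp_indicator_Iic μ a 2) N hc
  rw [integral_indicator_Iic] at h
  refine h.trans (ENNReal.ofReal_le_ofReal ?_)
  gcongr
  have : (fun x => (Set.Iic a).indicator (fun _ => (1 : ℝ)) x ^ 2) =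
      (Set.Iic a).indicator (fun _ => (1 : ℝ)) := by
    ext x
    by_cases hx : x ≤ a <;> simp [Set.indicator, hx]
  rw [this, integral_indicator_Iic]
  exact cdf_le_one μ a

lemma isBigOInProb_empiricalFluctuation (hindep : iIndepFun Y P) (hlaw : ∀ k, HasLaw (Y k) μ P)
    (a : ℝ) : IsBigOInProb P (fun N ω => empiricalFluctuation μ (fun k => Y k ω) N a) := by
  intro δ hδ
  have hlim : Tendsto (fun K : ℝ => ENNReal.ofReal (1 / K ^ 2)) atTop (𝓝 0) := by
    have : Tendsto (fun K : ℝ => 1 / K ^ 2) atTop (𝓝 0) :=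
      tendsto_const_nhds.div_atTop (tendsto_pow_atTop two_ne_zero)
    simpa using ENNReal.tendsto_ofReal this
  obtain ⟨K, hK, hK0⟩ :=
    ((ENNReal.tendsto_nhds_zero.1 hlim δ hδ).and (eventually_gt_atTop 0)).exists
  exact ⟨K, Eventually.of_forall fun N =>
    ((measure_le_abs_empiricalFluctuation_le hindep hlaw N a hK0).trans hK).trans'
      (measure_mono fun ω (hω : K < |empiricalFluctuation μ (fun k => Y k ω) N a|) => hω.le)⟩

/-- For `a ≤ b` the increment averages the indicator of `(a, b]`, whose second moment is `F(b) -
F(a)`; this is small when `F` is continuous and `a`, `b` are close. -/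
lemma measure_le_abs_empiricalFluctuation_sub_le (hindep : iIndepFun Y P)
    (hlaw : ∀ k, HasLaw (Y k) μ P) (N : ℕ) (a b : ℝ) {c : ℝ} (hc : 0 < c) :
    P {ω | c ≤ |empiricalFluctuation μ (fun k => Y k ω) N a -
      empiricalFluctuation μ (fun k => Y k ω) N b|} ≤
      ENNReal.ofReal (|cdf μ a - cdf μ b| / c ^ 2) := by
  wlog hab : a ≤ b generalizing a b
  · simpa only [abs_sub_comm] using this b a (le_of_not_ge hab)
  have hint : ∀ x, Integrable ((Set.Iic x).indicator (fun _ => (1 : ℝ))) μ := fun x =>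
    (memLp_indicator_Iic μ x 2).integrable one_le_two
  have h := measure_le_abs_sqrt_mul_mean_sub_le hindep hlaw
    ((measurable_const.indicator measurableSet_Iic).sub
      (measurable_const.indicator measurableSet_Iic))
    ((memLp_indicator_Iic μ b 2).sub (memLp_indicator_Iic μ a 2)) N hc
  have hsq : (fun x => ((Set.Iic b).indicator (fun _ => (1 : ℝ)) -
        (Set.Iic a).indicator (fun _ => (1 : ℝ))) x ^ 2) =
      fun x => (Set.Iic b).indicator (fun _ => (1 : ℝ)) x -
        (Set.Iic a).indicator (fun _ => (1 : ℝ)) x := by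
    ext x
    by_cases hx : x ≤ a
    · simp [Set.indicator, hx, hx.trans hab]
    · by_cases hx' : x ≤ b <;> simp [Set.indicator, hx, hx']
  rw [hsq] at h
  simp only [Pi.sub_apply] at h
  rw [integral_sub (hint b) (hint a), integral_indicator_Iic, integral_indicator_Iic] at h
  rw [abs_sub_comm, abs_of_nonneg (sub_nonneg.2 (monotone_cdf μ hab))]
  refine le_trans (le_of_eq ?_) h
  congr 1
  ext ω
  simp only [Set.mem_ofPred_eq]
  rw [abs_sub_comm]
  simp only [empiricalFluctuation, ecdf, Finset.sum_sub_distrib]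
  ring_nf

/-- The random part, an increment of the empirical process over a shrinking interval, vanishes by
continuity of `F` at `t`; the deterministic part is a difference quotient. -/
lemma isLittleOInProb_localFluctuation (hindep : iIndepFun Y P) (hlaw : ∀ k, HasLaw (Y k) μ P)
    {t d : ℝ} (hF : HasDerivAt (cdf μ) d t) (u : ℝ) :
    IsLittleOInProb P (fun N ω => localFluctuation μ t (fun k => Y k ω) N u -
      empiricalFluctuation μ (fun k => Y k ω) N t - d * u) := by
  have h1 : IsLittleOInProb P (fun N ω => empiricalFluctuation μ (fun k => Y k ω) N (t + u / √N) -
      empiricalFluctuation μ (fun k => Y k ω) N t) := by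
    intro c hc
    have hpt : Tendsto (fun N : ℕ => t + u / √N) atTop (𝓝 t) := by
      have : Tendsto (fun N : ℕ => u / √(N : ℝ)) atTop (𝓝 0) :=
        tendsto_const_nhds.div_atTop (Real.tendsto_sqrt_atTop.comp tendsto_natCast_atTop_atTop)
      simpa using this.const_add t
    have hlim : Tendsto (fun N : ℕ => ENNReal.ofReal
        (|cdf μ (t + u / √N) - cdf μ t| / c ^ 2)) atTop (𝓝 0) := by
      have := (((hF.continuousAt.tendsto.comp hpt).sub_const (cdf μ t)).abs).div_const (c ^ 2)
      simpa using ENNReal.tendsto_ofReal this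
    exact tendsto_of_tendsto_of_tendsto_of_le_of_le tendsto_const_nhds hlim (fun _ => zero_le)
      fun N => measure_le_abs_empiricalFluctuation_sub_le hindep hlaw N _ _ hc
  have h2 : IsLittleOInProb P (fun (N : ℕ) (_ : Ω) =>
      √N * (cdf μ (t + u / √N) - cdf μ t) - d * u) :=
    isLittleOInProb_of_tendsto (by simpa using (tendsto_sqrt_mul_increment hF u).sub_const (d * u))
  refine (h1.add h2).congr (Eventually.of_forall fun N ω => ?_)
  simp only [empiricalFluctuation, localFluctuation]
  ring

/-- The localised empirical process is asymptotically affine, uniformly on compact sets. -/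
lemma tendsto_measure_exists_localFluctuation (hindep : iIndepFun Y P)
    (hlaw : ∀ k, HasLaw (Y k) μ P) {t d : ℝ} (hF : HasDerivAt (cdf μ) d t) (K : ℝ) {ε : ℝ}
    (hε : 0 < ε) :
    Tendsto (fun N : ℕ => P {ω | ∃ u, |u| ≤ K ∧ ε ≤ |localFluctuation μ t (fun k => Y k ω) N u -
      empiricalFluctuation μ (fun k => Y k ω) N t - d * u|}) atTop (𝓝 0) := by
  -- The mesh keeps the interpolation error `|d| h` below `ε / 2`, leaving `ε / 2` at grid points.
  -- The grid does not depend on `N`, so a union bound suffices.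
  set h := ε / (2 * (|d| + 1)) with hh
  have hh0 : 0 < h := by positivity
  have hdh : |d| * h ≤ ε / 2 := by
    rw [hh, ← mul_div_assoc, div_le_div_iff₀ (by positivity) two_pos]
    nlinarith [abs_nonneg d]
  have hsum := tendsto_finsetSum (Finset.range (⌊2 * K / h⌋₊ + 2)) fun j _ =>
    isLittleOInProb_localFluctuation hindep hlaw hF (-K + j * h) (ε / 2) (by positivity)
  rw [Finset.sum_const_zero] at hsum
  refine tendsto_of_tendsto_of_tendsto_of_le_of_le tendsto_const_nhds hsum (fun _ => zero_le)
    fun N => (measure_mono ?_).trans (measure_biUnion_finset_le _ _)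
  rintro ω ⟨u, hu, hle⟩
  by_contra hn
  simp only [Set.mem_iUnion, Set.mem_ofPred_eq, exists_prop, not_exists, not_and, not_le] at hn
  have := abs_sub_affine_lt_of_grid (monotone_localFluctuation μ t (fun k => Y k ω) N) hh0 hn hu
  linarith

/-- Evaluation of the localised empirical process at random, stochastically bounded points. -/
lemma isLittleOInProb_localFluctuation_comp (hindep : iIndepFun Y P) (hlaw : ∀ k, HasLaw (Y k) μ P)
    {t d : ℝ} (hF : HasDerivAt (cdf μ) d t) {U : ℕ → Ω → ℝ} (hU : IsBigOInProb P U) :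
    IsLittleOInProb P (fun N ω => localFluctuation μ t (fun k => Y k ω) N (U N ω) -
      empiricalFluctuation μ (fun k => Y k ω) N t - d * U N ω) := by
  intro ε hε
  rw [ENNReal.tendsto_nhds_zero]
  intro δ hδ
  obtain ⟨K, hK⟩ := hU (δ / 2) (ENNReal.half_pos hδ.ne')
  filter_upwards [hK, ENNReal.tendsto_nhds_zero.1
    (tendsto_measure_exists_localFluctuation hindep hlaw hF K hε) (δ / 2)
    (ENNReal.half_pos hδ.ne')] with N h1 h2
  rw [← ENNReal.add_halves δ]
  refine ((measure_mono fun ω hω => ?_).trans (measure_union_le _ _)).trans (add_le_add h1 h2)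
  by_cases hb : K < |U N ω|
  · exact Or.inl hb
  · exact Or.inr ⟨U N ω, not_lt.1 hb, hω⟩

/-- The Bahadur representation of a normalised empirical quantile, in probability. -/
lemma isLittleOInProb_quantile_add (hindep : iIndepFun Y P) (hlaw : ∀ k, HasLaw (Y k) μ P)
    {t d : ℝ} (hF : HasDerivAt (cdf μ) d t) (hd : 0 < d) {V : ℕ → Ω → ℝ}
    (hV : ∀ᶠ N in atTop, ∀ ω u, V N ω ≤ u ↔ 0 ≤ localFluctuation μ t (fun k => Y k ω) N u) :
    IsLittleOInProb P (fun N ω => V N ω + empiricalFluctuation μ (fun k => Y k ω) N t / d) := by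
  intro ε hε
  rw [ENNReal.tendsto_nhds_zero]
  intro δ hδ
  obtain ⟨K, hK⟩ := (isBigOInProb_empiricalFluctuation hindep hlaw t) (δ / 2)
    (ENNReal.half_pos hδ.ne')
  -- If `|w| ≤ K`, the window `K / d + ε / 2` contains `-w/d ± ε/2`, where `w + d u = ± d ε/2`. An
  -- error below `ε / 2 * d` preserves these signs and traps `V` between the two points.
  filter_upwards [hK, hV, ENNReal.tendsto_nhds_zero.1
    (tendsto_measure_exists_localFluctuation hindep hlaw hF (K / d + ε / 2)
      (show 0 < ε / 2 * d by positivity)) (δ / 2) (ENNReal.half_pos hδ.ne')] with N h1 hVN h2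
  rw [← ENNReal.add_halves δ]
  refine ((measure_mono fun ω hω => ?_).trans (measure_union_le _ _)).trans (add_le_add h1 h2)
  set w := empiricalFluctuation μ (fun k => Y k ω) N t with hw
  by_contra hn
  simp only [Set.mem_union, Set.mem_ofPred_eq, not_or, not_lt, not_exists, not_and,
    not_le] at hn hω
  obtain ⟨hwK, hunif⟩ := hn
  rw [← hw] at hunif hwK
  have hwd : |w / d| ≤ K / d := by
    rw [abs_div, abs_of_pos hd]
    gcongr
  have hwd' := abs_le.1 hwd
  have hdw : d * (w / d) = w := by field_simp
  have hup : V N ω ≤ -(w / d) + ε / 2 := by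
    have := abs_lt.1 (hunif (-(w / d) + ε / 2) (abs_le.2 ⟨by linarith, by linarith⟩))
    rw [hVN]
    nlinarith [this.1]
  have hlow : ¬V N ω ≤ -(w / d) - ε / 2 := by
    have := abs_lt.1 (hunif (-(w / d) - ε / 2) (abs_le.2 ⟨by linarith, by linarith⟩))
    rw [hVN]
    nlinarith [this.2]
  have : |V N ω + w / d| ≤ ε / 2 := abs_le.2 ⟨by linarith [not_le.1 hlow], by linarith⟩
  linarith

end Sampling


/-- Left of the quantile `F < p`, so continuity gives `≤`; the Galois connection gives `≥`. -/
lemma cdf_quantile_eq (μ : Measure ℝ) {p : ℝ} (hp : p ∈ Set.Ioo (0 : ℝ) 1)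
    (hc : ContinuousAt (cdf μ) (quantile (cdf μ) p)) : cdf μ (quantile (cdf μ) p) = p := by
  refine le_antisymm ?_ ((quantile_cdf_le_iff μ hp _).1 le_rfl)
  refine le_of_tendsto (hc.tendsto.mono_left (nhdsWithin_le_nhds (s := Set.Iio (quantile (cdf μ) p)))) ?_
  filter_upwards [self_mem_nhdsWithin] with x hx
  by_contra! h
  exact absurd ((quantile_cdf_le_iff μ hp x).2 h.le) (not_le.2 hx)

/-! ### The asymptotic variance as a quadratic form. -/

section Covariance

variable {Ω : Type*} [MeasurableSpace Ω] {P : Measure Ω} [IsProbabilityMeasure P]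

lemma memLp_indicatorVector {n : ℕ} {X : Ω → Fin n → ℝ} (hX : AEMeasurable X P) (t : Fin n → ℝ)
    (j : Fin (n + 1)) (p : ENNReal) : MemLp (indicatorVector X t j) p P := by
  have key : ∀ φ : (Fin n → ℝ) → ℝ, Measurable φ → ∀ c : ℝ,
      MemLp (Set.indicator {ω | φ (X ω) ≤ c} (fun _ => (1 : ℝ))) p P := by
    intro φ hφ c
    refine MemLp.of_bound (C := 1) ?_ (ae_of_all _ fun ω => ?_)
    · have : Measurable ({x | φ x ≤ c}.indicator fun _ => (1 : ℝ)) :=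
        measurable_const.indicator (measurableSet_le hφ measurable_const)
      exact (this.comp_aemeasurable hX).aestronglyMeasurable
    · by_cases h : φ (X ω) ≤ c <;> simp [Set.indicator, h]
  refine Fin.lastCases ?_ (fun i => ?_) j
  · simpa [indicatorVector] using key (fun x => ∑ i, x i) (by fun_prop) (∑ i, t i)
  · simpa [indicatorVector] using key (fun x => x i) (by fun_prop) (t i)

/-- Bilinearity of covariance. It identifies the limit variance and shows that the quadratic form is
nonnegative. -/
lemma variance_sum_mul_eq_dotProduct {m : ℕ} {Y : Fin m → Ω → ℝ} (hY : ∀ j, MemLp (Y j) 2 P)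
    (a : Fin m → ℝ) :
    Var[fun ω => ∑ j, a j * Y j ω; P] = a ⬝ᵥ (covarianceMatrix P Y *ᵥ a) := by
  have hL : ∀ j, MemLp (fun ω => a j * Y j ω) 2 P := fun j => (hY j).const_mul _
  rw [← covariance_self (Finset.aemeasurable_fun_sum _ fun j _ => (hL j).aemeasurable),
    covariance_fun_sum_fun_sum hL hL]
  simp only [covariance_const_mul_left, covariance_const_mul_right, dotProduct, Matrix.mulVec,
    covarianceMatrix, Matrix.of_apply, Finset.mul_sum]
  refine Finset.sum_congr rfl fun i _ => Finset.sum_congr rfl fun j _ => ?_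
  ring

end Covariance

/-- The linear combination `x ↦ ∑ i, a i 1{x i ≤ t i} + b 1{∑ i, x i ≤ ∑ i, t i}`. -/
noncomputable def indicatorCombination {n : ℕ} (a : Fin n → ℝ) (b : ℝ) (t x : Fin n → ℝ) : ℝ :=
  ∑ i, a i * (Set.Iic (t i)).indicator (fun _ => (1 : ℝ)) (x i) +
    b * (Set.Iic (∑ i, t i)).indicator (fun _ => (1 : ℝ)) (∑ i, x i)

lemma measurable_indicatorCombination {n : ℕ} (a : Fin n → ℝ) (b : ℝ) (t : Fin n → ℝ) :
    Measurable (indicatorCombination a b t) := by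
  have h : ∀ c : ℝ, Measurable ((Set.Iic c).indicator fun _ => (1 : ℝ)) := fun c =>
    measurable_const.indicator measurableSet_Iic
  unfold indicatorCombination
  have h' := h (∑ i, t i)
  exact (Finset.measurable_sum _ fun i _ =>
    ((h (t i)).comp (measurable_pi_apply i)).const_mul _).add
      ((h'.comp (by fun_prop)).const_mul _)

lemma indicatorCombination_eq_sum {Ω : Type*} {n : ℕ} (a : Fin n → ℝ) (b : ℝ) (t : Fin n → ℝ)
    (X : Ω → Fin n → ℝ) (ω : Ω) :
    indicatorCombination a b t (X ω) =
      ∑ j, (Fin.snoc (α := fun _ => ℝ) a b : Fin (n + 1) → ℝ) j * indicatorVector X t j ω := by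
  rw [Fin.sum_univ_castSucc]
  simp only [Fin.snoc_castSucc, Fin.snoc_last, indicatorVector, indicatorCombination]
  rfl

/-! ### Central limit theorem and linearisation of the estimator. -/

section Sampling

variable {Ω : Type*} [MeasurableSpace Ω] {P : Measure Ω} [IsProbabilityMeasure P] {n : ℕ}

/-- The central limit theorem for linear combinations of the empirical processes of the
coordinates and of their sum, each at one point. -/
lemma tendstoInDistribution_empiricalFluctuation {X : Ω → Fin n → ℝ} {Xs : ℕ → Ω → Fin n → ℝ}
    (hindep : iIndepFun Xs P) (hident : ∀ k, IdentDistrib (Xs k) X P P) (t : Fin n → ℝ)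
    (a : Fin n → ℝ) (b : ℝ) :
    TendstoInDistribution (fun (N : ℕ) (ω : Ω) =>
        ∑ i, a i * empiricalFluctuation (P.map fun ω => X ω i) (fun k => Xs k ω i) N (t i) +
          b * empiricalFluctuation (P.map fun ω => ∑ i, X ω i) (fun k => ∑ i, Xs k ω i) N (∑ i, t i))
      atTop (id : ℝ → ℝ) (fun _ => P)
      (gaussianReal 0 (Var[fun ω => indicatorCombination a b t (X ω); P]).toNNReal) := by
  have hX : AEMeasurable X P := (hident 0).aemeasurable_snd
  set h := indicatorCombination a b t with hh
  have hm : Measurable h := measurable_indicatorCombination a b t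
  have hid : ∀ k, IdentDistrib (fun ω => h (Xs k ω)) (fun ω => h (X ω)) P P := fun k =>
    (hident k).comp hm
  have hLp : MemLp (fun ω => h (X ω)) 2 P := by
    simp only [hh, indicatorCombination_eq_sum]
    exact memLp_finsetSum _ fun j _ => (memLp_indicatorVector hX t j 2).const_mul _
  have hclt := tendstoInDistribution_inv_sqrt_mul_sum_sub (P := P)
    (P' := gaussianReal 0 (Var[fun ω => h (X ω); P]).toNNReal) (X := fun k ω => h (Xs k ω))
    (Y := id) (by rw [(hid 0).variance_eq]; exact HasLaw.id) ((hid 0).memLp_iff.2 hLp)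
    (hindep.comp (fun _ => h) fun _ => hm) (fun k => (hid k).trans (hid 0).symm)
  have hS : AEMeasurable (fun ω => ∑ i, X ω i) P :=
    (show Measurable fun x : Fin n → ℝ => ∑ i, x i by fun_prop).comp_aemeasurable hX
  have hXi : ∀ i, AEMeasurable (fun ω => X ω i) P := fun i =>
    (measurable_pi_apply i).comp_aemeasurable hX
  have hind : ∀ {Z : Ω → ℝ}, AEMeasurable Z P → ∀ c : ℝ,
      Integrable (fun ω => (Set.Iic c).indicator (fun _ => (1 : ℝ)) (Z ω)) P ∧
      ∫ ω, (Set.Iic c).indicator (fun _ => (1 : ℝ)) (Z ω) ∂P = cdf (P.map Z) c := by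
    intro Z hZ c
    have := Measure.isProbabilityMeasure_map hZ
    have hi := (memLp_indicator_Iic (P.map Z) c 1).integrable le_rfl
    refine ⟨hi.comp_aemeasurable hZ, ?_⟩
    rw [← integral_indicator_Iic, integral_map hZ hi.aestronglyMeasurable]
  have hmean : ∫ ω, h (Xs 0 ω) ∂P = ∑ i, a i * cdf (P.map fun ω => X ω i) (t i) +
      b * cdf (P.map fun ω => ∑ i, X ω i) (∑ i, t i) := by
    rw [(hid 0).integral_eq]
    simp only [hh, indicatorCombination]
    rw [integral_add (integrable_finsetSum _ fun i _ => (hind (hXi i) _).1.const_mul _)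
      ((hind hS _).1.const_mul _), integral_finsetSum _ fun i _ => (hind (hXi i) _).1.const_mul _]
    simp only [integral_const_mul, (hind hS _).2, (hind (hXi _) _).2]
  convert hclt using 3 with N ω
  rw [hmean]
  simp only [hh, indicatorCombination, empiricalFluctuation, ecdf, Finset.sum_add_distrib]
  -- Passes from a centred mean to the `(√N)⁻¹` scaling of the central limit theorem; both sides are
  -- `0` at `N = 0`.
  have hlin : ∀ x c : ℝ, √(N : ℝ) * ((N : ℝ)⁻¹ * x - c) = (√(N : ℝ))⁻¹ * (x - N * c) := by
    intro x c
    rcases N.eq_zero_or_pos with rfl | hN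
    · simp
    have hsq : √(N : ℝ) ≠ 0 := (Real.sqrt_pos.2 (by exact_mod_cast hN)).ne'
    conv_lhs => rw [← Real.sq_sqrt N.cast_nonneg]
    conv_rhs => rw [← Real.sq_sqrt (N.cast_nonneg : (0 : ℝ) ≤ N)]
    simp only [Real.sqrt_sq (Real.sqrt_nonneg _)]
    field_simp
  have hsum : ∀ x c : Fin n → ℝ, ∑ i, a i * ((√(N : ℝ))⁻¹ * (x i - N * c i)) =
      (√(N : ℝ))⁻¹ * (∑ i, a i * x i - N * ∑ i, a i * c i) := by
    intro x c
    rw [Finset.mul_sum, ← Finset.sum_sub_distrib, Finset.mul_sum]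
    exact Finset.sum_congr rfl fun i _ => by ring
  simp only [hlin]
  rw [hsum, Finset.sum_comm]
  simp only [← Finset.mul_sum]
  ring

/-- Asymptotic linearity of the empirical diversification quotient. -/
lemma isLittleOInProb_empiricalDQVaR_sub {α : ℝ} (hα : α ∈ Set.Ioo (0 : ℝ) 1)
    {X : Ω → Fin n → ℝ} {Xs : ℕ → Ω → Fin n → ℝ} (hindep : iIndepFun Xs P)
    (hident : ∀ k, IdentDistrib (Xs k) X P P) {t : Fin n → ℝ}
    (ht : ∀ i, t i = quantile (cdf (P.map fun ω => X ω i)) (1 - α)) {d : Fin n → ℝ}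
    (hd : ∀ i, HasDerivAt (cdf (P.map fun ω => X ω i)) (d i) (t i)) (hd_pos : ∀ i, 0 < d i)
    {e : ℝ} (he : HasDerivAt (cdf (P.map fun ω => ∑ i, X ω i)) e (∑ i, t i)) :
    IsLittleOInProb P (fun (N : ℕ) (ω : Ω) =>
      √N * (empiricalDQVaR N α (fun k => Xs k ω) - DQVaR P α X) -
        (∑ i, e / (α * d i) *
            empiricalFluctuation (P.map fun ω => X ω i) (fun k => Xs k ω i) N (t i) +
          -1 / α * empiricalFluctuation (P.map fun ω => ∑ i, X ω i) (fun k => ∑ i, Xs k ω i) N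
            (∑ i, t i))) := by
  have hX : AEMeasurable X P := (hident 0).aemeasurable_snd
  have hsumm : Measurable fun x : Fin n → ℝ => ∑ i, x i := by fun_prop
  have hS : AEMeasurable (fun ω => ∑ i, X ω i) P := hsumm.comp_aemeasurable hX
  have hXi : ∀ i, AEMeasurable (fun ω => X ω i) P := fun i =>
    (measurable_pi_apply i).comp_aemeasurable hX
  have : ∀ i, IsProbabilityMeasure (P.map fun ω => X ω i) := fun i =>
    Measure.isProbabilityMeasure_map (hXi i)
  have : IsProbabilityMeasure (P.map fun ω => ∑ i, X ω i) := Measure.isProbabilityMeasure_map hS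
  have hlawS : ∀ k, HasLaw (fun ω => ∑ i, Xs k ω i) (P.map fun ω => ∑ i, X ω i) P := fun k =>
    ⟨hsumm.comp_aemeasurable (hident k).aemeasurable_fst, ((hident k).comp hsumm).map_eq⟩
  have hlaw : ∀ i k, HasLaw (fun ω => Xs k ω i) (P.map fun ω => X ω i) P := fun i k =>
    ⟨(measurable_pi_apply i).comp_aemeasurable (hident k).aemeasurable_fst,
      ((hident k).comp (measurable_pi_apply i)).map_eq⟩
  have hindepS : iIndepFun (fun k ω => ∑ i, Xs k ω i) P :=
    hindep.comp (fun _ x => ∑ i, x i) fun _ => hsumm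
  have hindepi : ∀ i, iIndepFun (fun k ω => Xs k ω i) P := fun i =>
    hindep.comp (fun _ x => x i) fun _ => measurable_pi_apply i
  have hp : 1 - α ∈ Set.Ioo (0 : ℝ) 1 := ⟨by linarith [hα.2], by linarith [hα.1]⟩
  have hFt : ∀ i, cdf (P.map fun ω => X ω i) (t i) = 1 - α := fun i => by
    have := (hd i).continuousAt
    rw [ht i] at this ⊢
    exact cdf_quantile_eq _ hp this
  set V : Fin n → ℕ → Ω → ℝ := fun i N ω =>
    √N * (empiricalVaR N α (fun k => Xs k ω i) - t i) with hVdef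
  have hV : ∀ i, IsLittleOInProb P (fun N ω => V i N ω +
      empiricalFluctuation (P.map fun ω => X ω i) (fun k => Xs k ω i) N (t i) / d i) := by
    intro i
    refine isLittleOInProb_quantile_add (hindepi i) (hlaw i) (hd i) (hd_pos i) ?_
    filter_upwards [eventually_gt_atTop 0] with N hN ω u
    have hsq : 0 < √(N : ℝ) := Real.sqrt_pos.2 (by exact_mod_cast hN)
    simp only [hVdef]
    -- Since `F_i(t_i) = 1 - α`, the sign of the local process records whether the empirical
    -- distribution function has reached level `1 - α`.
    rw [localFluctuation, hFt i, mul_nonneg_iff_of_pos_left hsq, sub_nonneg,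
      ← empiricalVaR_le_iff hN.ne' hα, mul_comm, ← le_div_iff₀ hsq, sub_le_iff_le_add']
  set U : ℕ → Ω → ℝ := fun N ω => ∑ i, V i N ω with hUdef
  have hU : IsBigOInProb P U := by
    refine IsBigOInProb.sum _ fun i _ => ?_
    -- Writes `V = (V + W/d) - W/d`, a negligible term plus a tight one.
    refine ((hV i).isBigOInProb.add ((isBigOInProb_empiricalFluctuation (hindepi i) (hlaw i)
      (t i)).const_mul (-(d i)⁻¹))).congr (Eventually.of_forall fun N ω => ?_)
    ring
  have hloc := isLittleOInProb_localFluctuation_comp hindepS hlawS he hU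
  have hVsum := IsLittleOInProb.sum Finset.univ fun i _ => hV i
  -- With these factors the terms `± (e/α) ∑ V_i` cancel, leaving only the empirical processes.
  refine ((hloc.const_mul (-1 / α)).add (hVsum.const_mul (-e / α))).congr ?_
  filter_upwards [eventually_gt_atTop 0] with N hN ω
  have hsq : √(N : ℝ) ≠ 0 := (Real.sqrt_pos.2 (by exact_mod_cast hN)).ne'
  have hs : ∑ i, t i + U N ω / √N = ∑ i, empiricalVaR N α (fun k => Xs k ω i) := by
    simp only [hUdef, hVdef, ← Finset.mul_sum, Finset.sum_sub_distrib]
    field_simp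
    ring
  have hDQ : DQVaR P α X =
      (1 - cdf (P.map fun ω => ∑ i, X ω i) (∑ i, t i)) / α := by
    rw [DQVaR, alphaStar_eq hX, cdf_map_eq hS]
    simp only [VaR_eq_quantile (hXi _), ht]
  have hcoef : ∀ i, e / (α * d i) *
      empiricalFluctuation (P.map fun ω => X ω i) (fun k => Xs k ω i) N (t i) =
      e / α * (empiricalFluctuation (P.map fun ω => X ω i) (fun k => Xs k ω i) N (t i) / d i) := by
    intro i
    have := (hd_pos i).ne'
    have := hα.1.ne'
    field_simp
  simp only [hcoef, ← Finset.mul_sum, Finset.sum_add_distrib]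
  rw [hDQ, empiricalDQVaR_eq hN.ne', localFluctuation, hs]
  simp only [hUdef]
  ring

end Sampling

end DivQuot

theorem theorem2 {Ω : Type*} [MeasurableSpace Ω] (P : Measure Ω) [IsProbabilityMeasure P]
    {n : ℕ} (α : ℝ) (hα : α ∈ Set.Ioo (0 : ℝ) 1)
    -- the portfolio `X` and the i.i.d. samples `Xs 0, Xs 1, …` of it
    (X : Ω → Fin n → ℝ) (Xs : ℕ → Ω → Fin n → ℝ)
    (hindep : iIndepFun Xs P) (hident : ∀ k, IdentDistrib (Xs k) X P P)
    -- `t i = F_i⁻¹(1 - α)`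
    (t : Fin n → ℝ)
    (ht : ∀ i, t i = DivQuot.quantile (cdf (P.map (fun ω => X ω i))) (1 - α))
    -- `F_i` has a positive density `f i` at `t i`
    (f : Fin n → ℝ → ℝ)
    (hf : ∀ i, HasDerivAt (cdf (P.map (fun ω => X ω i))) (f i (t i)) (t i))
    (hf_pos : ∀ i, 0 < f i (t i))
    -- the sum has a density `g` near `∑ t i`, continuous (hence also bounded) at that point
    (g : ℝ → ℝ)
    (hg : DivQuot.HasDensityNear (P.map (fun ω => ∑ i, X ω i)) g (∑ i, t i))
    (hg_cont : ContinuousAt g (∑ i, t i)) :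
    0 ≤ DivQuot.asymptoticVariance P α X t f g ∧
    TendstoInDistribution
      (fun (N : ℕ) (ω : Ω) =>
        Real.sqrt N * (DivQuot.empiricalDQVaR N α (fun k => Xs k ω) - DivQuot.DQVaR P α X))
      atTop (id : ℝ → ℝ) (fun _ => P)
      (gaussianReal 0 (DivQuot.asymptoticVariance P α X t f g).toNNReal) := by

  have hX : AEMeasurable X P := (hident 0).aemeasurable_snd
  have hS : AEMeasurable (fun ω => ∑ i, X ω i) P :=
    (show Measurable fun x : Fin n → ℝ => ∑ i, x i by fun_prop).comp_aemeasurable hX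
  have := Measure.isProbabilityMeasure_map hS
  have hvar : Var[fun ω => DivQuot.indicatorCombination
      (fun i => g (∑ j, t j) / (α * f i (t i))) (-1 / α) t (X ω); P] =
      DivQuot.asymptoticVariance P α X t f g := by
    simp only [DivQuot.indicatorCombination_eq_sum]
    exact DivQuot.variance_sum_mul_eq_dotProduct
      (fun j => DivQuot.memLp_indicatorVector hX t j 2) _
  refine ⟨hvar ▸ variance_nonneg _ _, ?_⟩
  rw [← hvar]
  -- Slutsky: the estimator's error differs by `o_P(1)` from a linear combination with a Gaussian
  -- limit.
  refine tendstoInDistribution_of_tendstoInMeasure_sub _ _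
    (DivQuot.tendstoInDistribution_empiricalFluctuation hindep hident t _ _) ?_ fun N => ?_
  · rw [tendstoInMeasure_iff_norm]
    simpa only [Pi.zero_apply, sub_zero, Pi.sub_apply, Real.norm_eq_abs,
      DivQuot.IsLittleOInProb] using
      DivQuot.isLittleOInProb_empiricalDQVaR_sub hα hindep hident ht hf hf_pos
        (hg.hasDerivAt_cdf hg_cont)
  -- At `N = 0` the factor `√0 = 0` makes the variable constant, so measurability of the estimator
  -- is not needed there.
  · rcases eq_or_ne N 0 with rfl | hN
    · simp
    · exact (((DivQuot.measurable_empiricalDQVaR hN hα).comp_aemeasurable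
        (aemeasurable_pi_lambda _ fun k => (hident k).aemeasurable_fst)).sub_const _).const_mul _
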